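/- Let $(R,\mu)$ be a $\sigma$-finite nonatomic measure space, let $1\le p<\infty$ and $1\le s\le\infty$. For a (real or complex valued) $\mu$-measurable function $f$ on $R$ let $$f^*(t)=\inf\{y\ge 0:\ \mu\{x\in R: |f(x)|>y\}\le t\}\qquad(t>0)$$ be its non-increasing rearrangement, and put $$\|f\|_{p,s}=\Big(\int_0^\infty (t^{1/p}f^*(t))^s\,\frac{dt}{t}\Big)^{1/s}\quad(s<\infty),\qquad \|f\|_{p,\infty}=\sup_{t>0}t^{1/p}f^*(t).$$ Let $L^{p,s}(R,\mu)$ be the set of all measurable $f$ with $\|f\|_{p,s}<\infty$ (functions that agree almost everywhere being identified), and for $f\in L^{p,s}(R,\mu)$ let $$\|f\|_{(p,s)}=\inf\Big\{\sum_{k}\|f_k\|_{p,s}\Big\},$$ where the infimum is taken over all finite representations $f=\sum_k f_k$ with $f_k\in L^{p,s}(R,\mu)$. The same notation is used for functions on $\mathbb{R}_+=(0,\infty)$ with Lebesgue measure. Then, for every $f\in L^{p,s}(R,\mu)$, $$\|f\|_{(p,s)}=\|f^*\|_{(p,s)},$$ where the right-hand side is the decomposition norm of $f^*$ as a function on $\mathbb{R}_+$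 with Lebesgue measure. -/

import Mathlib

open MeasureTheory Set
open scoped ENNReal

noncomputable section

/-- A measure is nonatomic if it has no atoms, an atom being a measurable set `A` of positive
measure without measurable subsets `B` such that `0 < μ B < μ A`. (Mathlib's
`NullSingletonClass` only says that singletons are null sets, which is weaker.) -/
def IsNonatomic {R : Type*} [MeasurableSpace R] (μ : Measure R) : Prop :=
  ∀ A : Set R, MeasurableSet A → 0 < μ A →
    ∃ B : Set R, MeasurableSet B ∧ B ⊆ A ∧ 0 < μ B ∧ μ B < μ A

/-- The non-increasing rearrangement `f^*(t) = inf {y ≥ 0 : μ {x : |f x| > y} ≤ t}`, for `t ≥ 0`,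
with values in `[0, ∞]`. -/
def rearrangement {R E : Type*} [MeasurableSpace R] [NormedAddCommGroup E]
    (μ : Measure R) (f : R → E) (t : ℝ) : ℝ≥0∞ :=
  sInf {y : ℝ≥0∞ | μ {x | y < ‖f x‖ₑ} ≤ ENNReal.ofReal t}

/-- The Lorentz functional `‖f‖_{p,s} = (∫₀^∞ (t^{1/p} f^*(t))^s dt/t)^{1/s}`, which is
`sup_{t>0} t^{1/p} f^*(t)` if `s = ∞`. -/
def lorentzNorm {R E : Type*} [MeasurableSpace R] [NormedAddCommGroup E]
    (p : ℝ) (s : ℝ≥0∞) (μ : Measure R) (f : R → E) : ℝ≥0∞ :=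
  if s = ∞ then
    ⨆ t ∈ Ioi (0 : ℝ), ENNReal.ofReal (t ^ (1 / p)) * rearrangement μ f t
  else
    (∫⁻ t in Ioi (0 : ℝ),
      (ENNReal.ofReal (t ^ (1 / p)) * rearrangement μ f t) ^ s.toReal / ENNReal.ofReal t)
        ^ (1 / s.toReal)

/-- Membership in the Lorentz space `L^{p,s}(R, μ)`. -/
def MemLorentz {R E : Type*} [MeasurableSpace R] [NormedAddCommGroup E]
    (p : ℝ) (s : ℝ≥0∞) (μ : Measure R) (f : R → E) : Prop :=
  AEStronglyMeasurable f μ ∧ lorentzNorm p s μ f < ∞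

/-- The decomposition norm `‖f‖_{(p,s)}`: the infimum of `∑ k, ‖f_k‖_{p,s}` over all finite
families `f_k` in `L^{p,s}(R, μ)` such that `f = ∑ k, f_k` almost everywhere. -/
def decompositionNorm {R E : Type*} [MeasurableSpace R] [NormedAddCommGroup E]
    (p : ℝ) (s : ℝ≥0∞) (μ : Measure R) (f : R → E) : ℝ≥0∞ :=
  sInf {c : ℝ≥0∞ | ∃ (N : ℕ) (g : Fin N → R → E), (∀ k, MemLorentz p s μ (g k)) ∧
    (∀ᵐ x ∂μ, f x = ∑ k, g k x) ∧ c = ∑ k, lorentzNorm p s μ (g k)}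

end

/-! `f` and `f^*` have the same distribution function, and both underlying spaces are diffuse. So it
suffices to carry a decomposition `f = ∑ g_k` over to an equimeasurable `h` on a diffuse space, at
almost no cost, and to apply this in both directions. Fix `c > 1` and cut along the shells `c^(n-1)
< |f| ≤ c^n` and `c^(n-1) < |h| ≤ c^n`, which have equal finite measure. On the `n`-th shell of `h`,
diffuseness yields a vector `W` with the same law as the ratios `V = (g_k / f)_k` on the `n`-th
shell of `f`. Since `∑ V_k = 1` is a property of the law, `∑ W_k = 1` almost everywhere, so `F_k = h
W_k` decomposes `h`. On the shells `|F_k| ≤ c^n |W_k|` and `c^n |V_k| ≤ c |g_k|`, so the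
distribution function of `F_k` is at most that of `c g_k`. Let `c → 1`. The transfer is
`exists_transferred_decomposition`; it rests on `exists_measurable_map_eq_of_null_fibers` and
`IsNonatomic.isDiffuse`. -/

/-! ### Realising prescribed laws on diffuse spaces -/

open ProbabilityTheory unitInterval Filter Topology in
/-- The distribution function of a law without point masses transports it to the uniform law. -/
theorem exists_measurable_map_eq_volume_unitInterval (ρ : Measure ℝ) [IsProbabilityMeasure ρ]
    (hρ : ∀ c, ρ {c} = 0) : ∃ G : ℝ → I, Measurable G ∧ ρ.map G = volume := by
  have hcont : Continuous (cdf ρ) := by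
    rw [continuous_iff_continuousAt]
    intro a
    have h := (cdf ρ).measure_singleton a
    rw [measure_cdf, hρ a, eq_comm, ENNReal.ofReal_eq_zero, sub_nonpos] at h
    rw [(cdf ρ).mono.continuousAt_iff_leftLim_eq_rightLim, StieltjesFunction.rightLim_eq]
    exact le_antisymm ((cdf ρ).mono.leftLim_le le_rfl) h
  have hsurj : ∀ y : ℝ, 0 < y → y < 1 → ∃ x, cdf ρ x = y := by
    intro y h0 h1
    obtain ⟨a, ha⟩ := ((tendsto_cdf_atBot ρ).eventually (gt_mem_nhds h0)).exists
    obtain ⟨b, hb⟩ := ((tendsto_cdf_atTop ρ).eventually (lt_mem_nhds h1)).exists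
    exact mem_range_of_exists_le_of_exists_ge hcont ⟨a, ha.le⟩ ⟨b, hb.le⟩
  let G : ℝ → I := fun x => ⟨cdf ρ x, cdf_nonneg ρ x, cdf_le_one ρ x⟩
  have hG : Measurable G := hcont.measurable.subtype_mk
  refine ⟨G, hG, ?_⟩
  have : IsProbabilityMeasure (ρ.map G) := Measure.isProbabilityMeasure_map hG.aemeasurable
  refine Measure.ext_of_Iic _ _ fun y => ?_
  rw [Measure.map_apply hG measurableSet_Iic, unitInterval.volume_Iic]
  have hpre : G ⁻¹' Iic y = {x | cdf ρ x ≤ y} := rfl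
  rw [hpre]
  apply le_antisymm
  · rcases eq_or_lt_of_le y.2.2 with h1 | h1
    · rw [h1]; simpa using prob_le_one
    -- The level set `cdf = y` may be a whole interval, so a point of level `y` need not bound `{cdf
    -- ≤ y}`; a point of any level `z > y` does.
    · refine ge_of_tendsto (x := 𝓝[>] (y : ℝ)) (f := fun z : ℝ => ENNReal.ofReal z)
        (ENNReal.continuous_ofReal.continuousWithinAt) ?_
      filter_upwards [Ioo_mem_nhdsGT h1] with z hz
      obtain ⟨x, hx⟩ := hsurj z (y.2.1.trans_lt hz.1) hz.2
      rw [← hx, ofReal_cdf]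
      refine measure_mono fun t ht => ?_
      by_contra hlt
      have := (cdf ρ).mono (not_le.1 hlt).le
      have ht' : cdf ρ t ≤ y := ht
      linarith [hz.1]
  · rcases eq_or_lt_of_le y.2.1 with h0 | h0
    · simp [← h0]
    rcases eq_or_lt_of_le y.2.2 with h1 | h1
    · rw [h1]
      have : {x | cdf ρ x ≤ 1} = univ := eq_univ_of_forall fun x => cdf_le_one ρ x
      rw [this]; simp
    · obtain ⟨x, hx⟩ := hsurj y h0 h1
      rw [← hx, ofReal_cdf]
      exact measure_mono fun t ht => ((cdf ρ).mono ht)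

/-- On a finite measure space carrying a function with null level sets, every law of the same total
mass on a standard Borel space is attained. -/
theorem exists_measurable_map_eq_of_null_fibers {Y Z : Type*} [MeasurableSpace Y]
    [MeasurableSpace Z] [StandardBorelSpace Z] [Nonempty Z]
    (ν : Measure Y) [IsFiniteMeasure ν] {u : Y → ℝ} (hu : Measurable u)
    (hnull : ∀ c, ν {y | u y = c} = 0) (l : Measure Z) (hl : l univ = ν univ) :
    ∃ W : Y → Z, Measurable W ∧ ν.map W = l := by
  by_cases h0 : ν univ = 0
  · refine ⟨fun _ => Classical.arbitrary Z, measurable_const, ?_⟩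
    rw [h0, Measure.measure_univ_eq_zero] at hl
    rw [hl, Measure.measure_univ_eq_zero.1 h0, Measure.map_zero]
  have htop : ν univ ≠ ∞ := measure_ne_top ν univ
  set m := ν univ with hm
  have hinv : m * m⁻¹ = 1 := ENNReal.mul_inv_cancel h0 htop
  have : IsProbabilityMeasure (m⁻¹ • ν) := ⟨by simp [← hm, mul_comm, hinv]⟩
  have : IsProbabilityMeasure (m⁻¹ • l) := ⟨by simp [hl, mul_comm, hinv]⟩
  have : IsProbabilityMeasure ((m⁻¹ • ν).map u) :=
    Measure.isProbabilityMeasure_map hu.aemeasurable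
  obtain ⟨G, hG, hGm⟩ := exists_measurable_map_eq_volume_unitInterval ((m⁻¹ • ν).map u)
    (fun c => by
      rw [Measure.map_apply hu (measurableSet_singleton c)]
      simp only [Measure.smul_apply, smul_eq_mul]
      rw [show u ⁻¹' {c} = {y | u y = c} from rfl, hnull, mul_zero])
  -- `T` pushes the uniform law on `I` to the target law, so `T ∘ G ∘ u` passes through the uniform
  -- law.
  obtain ⟨T, hT, hTm⟩ := (m⁻¹ • l).exists_measurable_map_eq
  refine ⟨T ∘ G ∘ u, hT.comp (hG.comp hu), ?_⟩
  have h1 : (m⁻¹ • ν).map (T ∘ G ∘ u) = m⁻¹ • l := by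
    rw [← Measure.map_map hT (hG.comp hu), ← Measure.map_map hG hu, hGm, hTm]
  rw [Measure.map_smul] at h1
  have h2 := congrArg (fun k => m • k) h1
  simpa [smul_smul, hinv] using h2

/-- A measure is diffuse if every measurable set of finite measure carries a measurable real
function all of whose level sets are null. -/
def IsDiffuse {Y : Type*} [MeasurableSpace Y] (ν : Measure Y) : Prop :=
  ∀ A : Set Y, MeasurableSet A → ν A < ∞ →
    ∃ u : Y → ℝ, Measurable u ∧ ∀ c, ν.restrict A {y | u y = c} = 0

theorem isDiffuse_of_nullSingleton (ν : Measure ℝ) (h : ∀ c, ν {c} = 0) : IsDiffuse ν :=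
  fun _ _ _ => ⟨id, measurable_id, fun c =>
    le_antisymm ((Measure.restrict_apply_le _ _).trans (h c).le) (zero_le)⟩

/-- Minimise the `ν × ν` mass of `{u(x) = u(y)}` over measurable `u`. A minimiser exists because a
minimising sequence can be coded into one real function, whose coincidence set lies in each of
theirs. A level set of positive mass could be split by nonatomicity, and recording the splitting
would lower the minimum. -/
theorem IsNonatomic.exists_null_fibers {Y : Type*} [MeasurableSpace Y] (ν : Measure Y)
    [IsFiniteMeasure ν] (h : IsNonatomic ν) :
    ∃ u : Y → ℝ, Measurable u ∧ ∀ c, ν {y | u y = c} = 0 := by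
  let Φ : {u : Y → ℝ // Measurable u} → ℝ≥0∞ := fun u => (ν.prod ν) {q | u.1 q.1 = u.1 q.2}
  have : Nonempty {u : Y → ℝ // Measurable u} := ⟨⟨fun _ => 0, measurable_const⟩⟩
  obtain ⟨w, -, hw1, hw2⟩ := exists_seq_tendsto_sInf (range_nonempty Φ) (OrderBot.bddBelow _)
  choose v hv using hw2
  let u : Y → ℝ := fun y => embeddingReal (ℕ → ℝ) (fun n => (v n).1 y)
  have hemb := measurableEmbedding_embeddingReal (ℕ → ℝ)
  have hu : Measurable u := hemb.measurable.comp (measurable_pi_lambda _ fun n => (v n).2)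
  have hmin : ∀ t : Y → ℝ, Measurable t →
      (ν.prod ν) {q | u q.1 = u q.2} ≤ (ν.prod ν) {q | t q.1 = t q.2} := by
    intro t ht
    have h1 : (ν.prod ν) {q | u q.1 = u q.2} ≤ sInf (range Φ) := by
      refine ge_of_tendsto' hw1 fun n => ?_
      rw [← hv n]
      exact measure_mono fun q hq => congrFun (hemb.injective hq) n
    exact h1.trans (sInf_le ⟨⟨t, ht⟩, rfl⟩)
  refine ⟨u, hu, fun c => ?_⟩
  by_contra hc
  have hA : MeasurableSet {y | u y = c} := hu (measurableSet_singleton c)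
  obtain ⟨B, hB, hBA, hB0, hB1⟩ := h _ hA (pos_iff_ne_zero.2 hc)
  let t : Y → ℝ := fun y => embeddingReal (ℝ × Prop) (u y, y ∈ B)
  have hemb' := measurableEmbedding_embeddingReal (ℝ × Prop)
  have ht : Measurable t := hemb'.measurable.comp (hu.prodMk (measurable_mem.2 hB))
  have hdiff : 0 < ν ({y | u y = c} \ B) := by
    rw [measure_sdiff hBA hB.nullMeasurableSet (measure_ne_top _ _)]
    exact tsub_pos_of_lt hB1
  have hsub : {q : Y × Y | t q.1 = t q.2} ⊆
      {q | u q.1 = u q.2} \ (B ×ˢ ({y | u y = c} \ B)) := by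
    intro q hq
    have := hemb'.injective hq
    simp only [Prod.mk.injEq, eq_iff_iff] at this
    refine ⟨this.1, fun hm => hm.2.2 (this.2.1 hm.1)⟩
  have hsub2 : B ×ˢ ({y | u y = c} \ B) ⊆ {q : Y × Y | u q.1 = u q.2} := by
    rintro ⟨a, b⟩ ⟨ha, hb⟩
    exact (hBA ha : u a = c).trans (hb.1 : u b = c).symm
  have hpos : 0 < (ν.prod ν) (B ×ˢ ({y | u y = c} \ B)) := by
    rw [Measure.prod_prod]
    exact ENNReal.mul_pos hB0.ne' hdiff.ne'
  have hlt : (ν.prod ν) {q | t q.1 = t q.2} < (ν.prod ν) {q | u q.1 = u q.2} := by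
    refine (measure_mono hsub).trans_lt ?_
    rw [measure_sdiff hsub2 (hB.prod (hA.diff hB)).nullMeasurableSet (measure_ne_top _ _)]
    refine ENNReal.sub_lt_self (measure_ne_top _ _) ?_ hpos.ne'
    exact (hpos.trans_le (measure_mono hsub2)).ne'
  exact (hmin t ht).not_gt hlt

theorem IsNonatomic.isDiffuse {Y : Type*} [MeasurableSpace Y] {ν : Measure Y}
    (h : IsNonatomic ν) : IsDiffuse ν := by
  intro A hA hfin
  have : IsFiniteMeasure (ν.restrict A) := ⟨by simpa using hfin⟩
  refine IsNonatomic.exists_null_fibers _ fun S hS hpos => ?_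
  rw [Measure.restrict_apply hS] at hpos
  obtain ⟨B, hB, hBS, h0, h1⟩ := h _ (hS.inter hA) hpos
  have : B ∩ A = B := inter_eq_left.2 fun x hx => (hBS hx).2
  refine ⟨B, hB, hBS.trans inter_subset_left, ?_, ?_⟩
  · rwa [Measure.restrict_apply hB, this]
  · rwa [Measure.restrict_apply hB, Measure.restrict_apply hS, this]

/-! ### Rearrangements and Lorentz functionals -/

section Lorentz

variable {X Y E F : Type*} [MeasurableSpace X] [MeasurableSpace Y] [NormedAddCommGroup E]
  [NormedAddCommGroup F] {μ : Measure X} {ν : Measure Y} {f : X → E} {g : Y → F}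

theorem rearrangement_antitone (μ : Measure X) (f : X → E) : Antitone (rearrangement μ f) :=
  fun _ _ h => sInf_le_sInf fun _ hy => le_trans hy (ENNReal.ofReal_le_ofReal h)

theorem rearrangement_le_mul {c : ℝ≥0∞} (hc0 : c ≠ 0) (hc : c ≠ ∞)
    (h : ∀ y, ν {x | y < ‖g x‖ₑ} ≤ μ {x | y < c * ‖f x‖ₑ}) (t : ℝ) :
    rearrangement ν g t ≤ c * rearrangement μ f t := by
  rw [mul_comm, ← ENNReal.div_le_iff_le_mul (Or.inl hc0) (Or.inl hc)]
  refine le_sInf fun z hz => ?_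
  rw [ENNReal.div_le_iff_le_mul (Or.inl hc0) (Or.inl hc)]
  refine sInf_le ((h _).trans (le_trans (measure_mono fun x hx => ?_) hz))
  have hx' : z * c < c * ‖f x‖ₑ := hx
  rw [mul_comm] at hx'
  exact lt_of_mul_lt_mul_left' hx'

theorem rearrangement_congr (h : ∀ y, ν {x | y < ‖g x‖ₑ} = μ {x | y < ‖f x‖ₑ}) :
    rearrangement ν g = rearrangement μ f := by
  ext t
  simp only [rearrangement, h]

theorem lorentzNorm_congr (p : ℝ) (s : ℝ≥0∞)
    (h : ∀ y, ν {x | y < ‖g x‖ₑ} = μ {x | y < ‖f x‖ₑ}) :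
    lorentzNorm p s ν g = lorentzNorm p s μ f := by
  simp only [lorentzNorm, rearrangement_congr h]

theorem measure_lt_enorm_congr {f' : X → E} (h : f =ᵐ[μ] f') (y : ℝ≥0∞) :
    μ {x | y < ‖f x‖ₑ} = μ {x | y < ‖f' x‖ₑ} := by
  refine measure_congr ?_
  filter_upwards [h] with x hx
  change (y < ‖f x‖ₑ) = (y < ‖f' x‖ₑ)
  rw [hx]

theorem lorentzNorm_le_mul (p : ℝ) {s : ℝ≥0∞} (hs : 1 ≤ s) {c : ℝ≥0∞} (hc0 : c ≠ 0) (hc : c ≠ ∞)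
    (h : ∀ y, ν {x | y < ‖g x‖ₑ} ≤ μ {x | y < c * ‖f x‖ₑ}) :
    lorentzNorm p s ν g ≤ c * lorentzNorm p s μ f := by
  have hr := rearrangement_le_mul hc0 hc h
  by_cases hs' : s = ∞
  · simp only [lorentzNorm, if_pos hs']
    refine iSup₂_le fun t ht => ?_
    calc _ ≤ ENNReal.ofReal (t ^ (1 / p)) * (c * rearrangement μ f t) := by gcongr; exact hr t
      _ = c * (ENNReal.ofReal (t ^ (1 / p)) * rearrangement μ f t) := by ring
      _ ≤ _ := by
        gcongr
        exact le_iSup₂ (f := fun (t : ℝ) (_ : t ∈ Ioi (0 : ℝ)) =>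
          ENNReal.ofReal (t ^ (1 / p)) * rearrangement μ f t) t ht
  · have hpos : 0 < s.toReal :=
      ENNReal.toReal_pos (zero_lt_one.trans_le hs).ne' hs'
    simp only [lorentzNorm, if_neg hs']
    have hc2 : c ^ s.toReal ≠ ∞ := ENNReal.rpow_ne_top_of_nonneg hpos.le hc
    calc _ ≤ (∫⁻ t in Ioi (0 : ℝ), c ^ s.toReal * ((ENNReal.ofReal (t ^ (1 / p)) *
            rearrangement μ f t) ^ s.toReal / ENNReal.ofReal t)) ^ (1 / s.toReal) := by
          gcongr with t
          rw [← mul_div_assoc, ← ENNReal.mul_rpow_of_nonneg _ _ hpos.le, mul_left_comm]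
          gcongr
          exact hr t
      _ = _ := by
          rw [lintegral_const_mul' _ _ hc2, ENNReal.mul_rpow_of_nonneg _ _ (by positivity),
            ← ENNReal.rpow_mul, mul_one_div_cancel hpos.ne', ENNReal.rpow_one]

/-- For finite `s`, restrict the integral to `(t/2, t]`: there `f^*(r) ≥ f^*(t)`, `r^(1/p) ≥
(t/2)^(1/p)` and `1/r ≥ 1/t`. The two factors of `κ` come from the length `t/2` and from
`(t/2)^(1/p)`. -/
theorem exists_mul_rearrangement_le_lorentzNorm {p : ℝ} {s : ℝ≥0∞} (hs : 1 ≤ s)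
    (μ : Measure X) (f : X → E) (hp : 0 < p) :
    ∃ κ : ℝ≥0∞, κ ≠ 0 ∧ ∀ t : ℝ, 0 < t →
      κ * ENNReal.ofReal (t ^ (1 / p)) * rearrangement μ f t ≤ lorentzNorm p s μ f := by
  by_cases hs' : s = ∞
  · refine ⟨1, one_ne_zero, fun t ht => ?_⟩
    simp only [lorentzNorm, if_pos hs', one_mul]
    exact le_iSup₂ (f := fun (t : ℝ) (_ : t ∈ Ioi (0 : ℝ)) =>
          ENNReal.ofReal (t ^ (1 / p)) * rearrangement μ f t) t ht
  have hpos : 0 < s.toReal := ENNReal.toReal_pos (zero_lt_one.trans_le hs).ne' hs'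
  refine ⟨(1 / 2) ^ (1 / s.toReal) * ENNReal.ofReal ((1 / 2) ^ (1 / p)), ?_, fun t ht => ?_⟩
  · refine mul_ne_zero ?_ ?_
    · exact (ENNReal.rpow_pos (by simp) (by simp)).ne'
    · rw [Ne, ENNReal.ofReal_eq_zero, not_le]; positivity
  simp only [lorentzNorm, if_neg hs']
  set x := ENNReal.ofReal ((t / 2) ^ (1 / p)) * rearrangement μ f t with hx
  have hxe : (1 / 2) ^ (1 / s.toReal) * ENNReal.ofReal ((1 / 2) ^ (1 / p)) *
      ENNReal.ofReal (t ^ (1 / p)) * rearrangement μ f t = (x ^ s.toReal * (1 / 2)) ^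
        (1 / s.toReal) := by
    rw [ENNReal.mul_rpow_of_nonneg _ _ (by positivity), ← ENNReal.rpow_mul,
      mul_one_div_cancel hpos.ne', ENNReal.rpow_one, hx,
      show t / 2 = (1 / 2) * t by ring, Real.mul_rpow (by norm_num) ht.le,
      ENNReal.ofReal_mul (by positivity)]
    ring
  rw [hxe]
  gcongr
  have ht0 : ENNReal.ofReal t ≠ 0 := by simpa using ht
  calc x ^ s.toReal * (1 / 2)
      = ∫⁻ _ in Ioc (t / 2) t, x ^ s.toReal / ENNReal.ofReal t := by
        rw [setLIntegral_const, Real.volume_Ioc, show t - t / 2 = t * (1 / 2) by ring,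
          ENNReal.ofReal_mul ht.le, ← mul_assoc, ENNReal.div_mul_cancel ht0 ENNReal.ofReal_ne_top]
        congr 1
        rw [ENNReal.ofReal_div_of_pos (by norm_num)]
        simp
    _ ≤ ∫⁻ r in Ioc (t / 2) t, (ENNReal.ofReal (r ^ (1 / p)) * rearrangement μ f r) ^ s.toReal /
          ENNReal.ofReal r := by
        refine setLIntegral_mono' measurableSet_Ioc fun r hr => ?_
        have hr1 : t / 2 ≤ r := hr.1.le
        have hr2 := hr.2
        rw [hx]
        gcongr
        exact rearrangement_antitone μ f hr2
    _ ≤ _ := lintegral_mono_set fun r hr => lt_of_lt_of_le (by positivity) hr.1.le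

theorem rearrangement_lt_top {p : ℝ} {s : ℝ≥0∞} (hs : 1 ≤ s) (hp : 0 < p)
    (h : lorentzNorm p s μ f < ∞) {t : ℝ} (ht : 0 < t) : rearrangement μ f t < ∞ := by
  obtain ⟨κ, hκ, hb⟩ := exists_mul_rearrangement_le_lorentzNorm hs μ f hp
  refine lt_top_iff_ne_top.2 fun htop => ?_
  have h1 := (hb t ht).trans_lt h
  have : ENNReal.ofReal (t ^ (1 / p)) ≠ 0 := by
    rw [Ne, ENNReal.ofReal_eq_zero, not_le]; positivity
  rw [htop, ENNReal.mul_top (mul_ne_zero hκ this)] at h1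
  exact lt_irrefl _ h1

theorem measure_lt_enorm_lt_top {p : ℝ} {s : ℝ≥0∞} (hs : 1 ≤ s) (hp : 0 < p)
    (h : lorentzNorm p s μ f < ∞) {y : ℝ≥0∞} (hy : y ≠ 0) : μ {x | y < ‖f x‖ₑ} < ∞ := by
  obtain ⟨κ, hκ, hb⟩ := exists_mul_rearrangement_le_lorentzNorm hs μ f hp
  refine lt_top_iff_ne_top.2 fun htop => ?_
  have hle : ∀ t, y ≤ rearrangement μ f t := by
    refine fun t => le_sInf fun z hz => ?_
    by_contra hlt
    have : μ {x | y < ‖f x‖ₑ} ≤ ENNReal.ofReal t :=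
      le_trans (measure_mono fun x hx => (not_le.1 hlt).trans hx) hz
    rw [htop] at this
    exact ENNReal.ofReal_ne_top (top_le_iff.1 this)
  -- As `f^* ≥ y` everywhere, the Lorentz functional dominates `κ y t^(1/p)` for every `t > 0`,
  -- which is unbounded.
  have hlim : Filter.Tendsto (fun t : ℝ => κ * y * ENNReal.ofReal (t ^ (1 / p))) Filter.atTop
      (nhds (κ * y * ∞)) :=
    ENNReal.Tendsto.const_mul (ENNReal.tendsto_ofReal_nhds_top.2
      (tendsto_rpow_atTop (by positivity))) (Or.inl ENNReal.top_ne_zero)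
  have : κ * y * ∞ ≤ lorentzNorm p s μ f := by
    refine le_of_tendsto hlim ?_
    filter_upwards [Filter.eventually_gt_atTop 0] with t ht
    refine le_trans ?_ (hb t ht)
    rw [mul_right_comm]
    gcongr
    exact hle t
  rw [ENNReal.mul_top (mul_ne_zero hκ hy)] at this
  exact absurd h (not_lt.2 this)

/-- The nontrivial direction is right continuity of the distribution function: the sets `{z_n <
|f|}` increase to `{y < |f|}` as `z_n` decreases to `y`. -/
theorem lt_rearrangement_iff {y : ℝ≥0∞} {t : ℝ} :
    y < rearrangement μ f t ↔ ENNReal.ofReal t < μ {x | y < ‖f x‖ₑ} := by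
  constructor
  · intro h
    by_contra hle
    have : rearrangement μ f t ≤ y := sInf_le (not_lt.1 hle)
    exact this.not_gt h
  · intro h
    have hy : y < ∞ := by
      rw [lt_top_iff_ne_top]
      rintro rfl
      simp at h
    obtain ⟨z, hz, hzy, hlim⟩ := exists_seq_strictAnti_tendsto' hy
    have hU : {x | y < ‖f x‖ₑ} = ⋃ n, {x | z n < ‖f x‖ₑ} := by
      ext x
      simp only [mem_ofPred_eq, mem_iUnion]
      exact ⟨fun hx => (hlim.eventually (gt_mem_nhds hx)).exists,
        fun ⟨n, hn⟩ => (hzy n).1.trans hn⟩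
    have hmono : Monotone fun n => {x | z n < ‖f x‖ₑ} :=
      fun m n hmn x hx => (hz.antitone hmn).trans_lt hx
    rw [hU, hmono.measure_iUnion, lt_iSup_iff] at h
    obtain ⟨n, hn⟩ := h
    refine (hzy n).1.trans_le (le_sInf fun w hw => ?_)
    by_contra hlt
    exact (le_trans (measure_mono fun x hx => (not_le.1 hlt).trans hx) hw).not_gt hn

/-- Equimeasurability of `f` and `f^*`: by `lt_rearrangement_iff`, the superlevel set of `f^*` is
the interval of positive `t` below `μ {|f| > y}`. -/
theorem volume_lt_enorm_rearrangement {𝕜 : Type*} [RCLike 𝕜]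
    (hfin : ∀ t : ℝ, 0 < t → rearrangement μ f t < ∞) (y : ℝ≥0∞) :
    (volume : Measure ℝ).restrict (Ioi 0)
      {t | y < ‖(((rearrangement μ f t).toReal : ℝ) : 𝕜)‖ₑ} = μ {x | y < ‖f x‖ₑ} := by
  rw [Measure.restrict_apply' measurableSet_Ioi]
  have hset : {t | y < ‖(((rearrangement μ f t).toReal : ℝ) : 𝕜)‖ₑ} ∩ Ioi 0 =
      {t | ENNReal.ofReal t < μ {x | y < ‖f x‖ₑ}} ∩ Ioi 0 := by
    ext t
    simp only [mem_inter_iff, mem_ofPred_eq, mem_Ioi, and_congr_left_iff]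
    intro ht
    rw [← lt_rearrangement_iff, ← ofReal_norm, RCLike.norm_ofReal,
      abs_of_nonneg ENNReal.toReal_nonneg, ENNReal.ofReal_toReal (hfin t ht).ne]
  rw [hset]
  by_cases hD : μ {x | y < ‖f x‖ₑ} = ∞
  · simp [hD]
  · have : {t | ENNReal.ofReal t < μ {x | y < ‖f x‖ₑ}} ∩ Ioi 0 =
        Ioo 0 (μ {x | y < ‖f x‖ₑ}).toReal := by
      ext t
      simp only [mem_inter_iff, mem_ofPred_eq, mem_Ioi, mem_Ioo]
      rw [and_comm]
      refine and_congr_right fun ht => ?_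
      rw [ENNReal.ofReal_lt_iff_lt_toReal ht.le hD]
    rw [this, Real.volume_Ioo, sub_zero, ENNReal.ofReal_toReal hD]

end Lorentz

/-! ### Transferring decompositions between equimeasurable functions -/

section Transfer

variable {𝕜 : Type*} [RCLike 𝕜] {X Y : Type*} [MeasurableSpace X] [MeasurableSpace Y]
  {μ : Measure X} {ν : Measure Y}

/-- The set of nonzero scalars of norm in `(c ^ (n - 1), c ^ n]`. -/
def normShell (𝕜 : Type*) [RCLike 𝕜] (c : ℝ) (n : ℤ) : Set 𝕜 :=
  {z | z ≠ 0 ∧ ⌈Real.logb c ‖z‖⌉ = n}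

theorem mem_normShell_iff {c : ℝ} (hc : 1 < c) {n : ℤ} {z : 𝕜} :
    z ∈ normShell 𝕜 c n ↔ c ^ (n - 1) < ‖z‖ ∧ ‖z‖ ≤ c ^ n := by
  have hc0 : 0 < c := zero_lt_one.trans hc
  have key : ∀ {w : 𝕜}, w ≠ 0 →
      (⌈Real.logb c ‖w‖⌉ = n ↔ c ^ (n - 1) < ‖w‖ ∧ ‖w‖ ≤ c ^ n) := by
    intro w hw
    rw [Int.ceil_eq_iff, Real.lt_logb_iff_rpow_lt hc (norm_pos_iff.2 hw),
      Real.logb_le_iff_le_rpow hc (norm_pos_iff.2 hw), Real.rpow_intCast,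
      ← Int.cast_one, ← Int.cast_sub, Real.rpow_intCast]
  constructor
  · rintro ⟨h0, hn⟩
    exact (key h0).1 hn
  · intro h
    have h0 : z ≠ 0 := norm_pos_iff.1 ((zpow_pos hc0 _).trans h.1)
    exact ⟨h0, (key h0).2 h⟩

theorem measurable_ceil_logb_norm (c : ℝ) : Measurable fun z : 𝕜 => ⌈Real.logb c ‖z‖⌉ :=
  Int.measurable_ceil.comp ((Real.measurable_log.comp measurable_norm).div_const _)

theorem measurableSet_normShell (c : ℝ) (n : ℤ) : MeasurableSet (normShell 𝕜 c n) :=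
  (measurableSet_singleton 0).compl.inter
    (measurable_ceil_logb_norm c (measurableSet_singleton n))

theorem measure_preimage_normShell {c : ℝ} (hc : 1 < c) {f : X → 𝕜} (hf : Measurable f)
    (hfin : ∀ y, y ≠ 0 → μ {x | y < ‖f x‖ₑ} < ∞) (n : ℤ) :
    μ (f ⁻¹' normShell 𝕜 c n) = μ {x | ENNReal.ofReal (c ^ (n - 1)) < ‖f x‖ₑ} -
      μ {x | ENNReal.ofReal (c ^ n) < ‖f x‖ₑ} := by
  have hc0 : 0 < c := zero_lt_one.trans hc
  have hpos : ENNReal.ofReal (c ^ n) ≠ 0 := by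
    rw [Ne, ENNReal.ofReal_eq_zero, not_le]; positivity
  rw [← measure_sdiff _ (measurableSet_lt measurable_const hf.enorm).nullMeasurableSet
    (hfin _ hpos).ne]
  · congr 1
    ext x
    simp only [mem_preimage, mem_normShell_iff hc, mem_sdiff, mem_ofPred_eq, not_lt]
    rw [← ofReal_norm, ENNReal.ofReal_lt_ofReal_iff_of_nonneg (by positivity),
      ENNReal.ofReal_le_ofReal_iff (by positivity)]
  · intro x hx
    refine lt_of_le_of_lt (ENNReal.ofReal_le_ofReal ?_) hx
    exact zpow_le_zpow_right₀ hc.le (by lia)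

/-- A finite decomposition of `f` can be transferred to any equimeasurable function `h` on a
diffuse space, with a loss in the distribution functions of the terms as small as desired. -/
theorem exists_transferred_decomposition (hν : IsDiffuse ν) {f : X → 𝕜} {h : Y → 𝕜}
    (hf : Measurable f) (hh : Measurable h)
    (hdist : ∀ y, ν {x | y < ‖h x‖ₑ} = μ {x | y < ‖f x‖ₑ})
    (hfin : ∀ y, y ≠ 0 → μ {x | y < ‖f x‖ₑ} < ∞) {N : ℕ} {g : Fin N → X → 𝕜}
    (hg : ∀ k, Measurable (g k)) (hsum : ∀ᵐ x ∂μ, f x = ∑ k, g k x) {c : ℝ} (hc : 1 < c) :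
    ∃ F : Fin N → Y → 𝕜, (∀ k, Measurable (F k)) ∧ (∀ᵐ y ∂ν, h y = ∑ k, F k y) ∧
      ∀ k a, ν {y | a < ‖F k y‖ₑ} ≤ μ {x | a < ENNReal.ofReal c * ‖g k x‖ₑ} := by
  have hc0 : 0 < c := zero_lt_one.trans hc
  set A : ℤ → Set X := fun n => f ⁻¹' normShell 𝕜 c n with hA
  set B : ℤ → Set Y := fun n => h ⁻¹' normShell 𝕜 c n with hB
  have hAm : ∀ n, MeasurableSet (A n) := fun n => hf (measurableSet_normShell c n)
  have hBm : ∀ n, MeasurableSet (B n) := fun n => hh (measurableSet_normShell c n)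
  have hAB : ∀ n, ν (B n) = μ (A n) := fun n => by
    simp only [hA, hB]
    rw [measure_preimage_normShell hc hf hfin, measure_preimage_normShell hc hh, hdist, hdist]
    exact fun y hy => hdist y ▸ hfin y hy
  have hAfin : ∀ n, μ (A n) < ∞ := fun n => by
    simp only [hA]
    rw [measure_preimage_normShell hc hf hfin]
    refine tsub_le_self.trans_lt (hfin _ ?_)
    rw [Ne, ENNReal.ofReal_eq_zero, not_le]; positivity
  -- Division by zero is harmless: the zeros of `f` lie in no shell. What the `g k` do there is
  -- discarded.
  let V : X → Fin N → 𝕜 := fun x k => g k x / f x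
  have hV : Measurable V := measurable_pi_lambda _ fun k => (hg k).div hf
  have hex : ∀ n, ∃ W : Y → Fin N → 𝕜, Measurable W ∧
      (ν.restrict (B n)).map W = (μ.restrict (A n)).map V := by
    intro n
    have hBfin : ν (B n) < ∞ := hAB n ▸ hAfin n
    have : IsFiniteMeasure (ν.restrict (B n)) := ⟨by simpa using hBfin⟩
    obtain ⟨u, hu, hnull⟩ := hν _ (hBm n) hBfin
    refine exists_measurable_map_eq_of_null_fibers _ hu hnull _ ?_
    rw [Measure.map_apply hV MeasurableSet.univ]
    simp [hAB n]
  choose W hW hWmap using hex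
  have hlaw : ∀ n (S : Set (Fin N → 𝕜)), MeasurableSet S →
      ν.restrict (B n) (W n ⁻¹' S) = μ.restrict (A n) (V ⁻¹' S) := by
    intro n S hS
    rw [← Measure.map_apply (hW n) hS, hWmap, Measure.map_apply hV hS]
  -- The index of the shell containing `y`; its value at zeros of `h` is irrelevant, since `F k`
  -- carries the factor `h`.
  let idx : Y → ℤ := fun y => ⌈Real.logb c ‖h y‖⌉
  have hidx : Measurable idx := (measurable_ceil_logb_norm c).comp hh
  have hWidx : Measurable fun y => W (idx y) y :=
    (measurable_from_prod_countable_right (f := fun q : ℤ × Y => W q.1 q.2) hW).comp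
      (hidx.prodMk measurable_id)
  refine ⟨fun k y => h y * W (idx y) y k, fun k => hh.mul ((measurable_pi_apply k).comp hWidx),
    ?_, fun k a => ?_⟩
  · have hone : ∀ n, ∀ᵐ y ∂ν, y ∈ B n → ∑ k, W n y k = 1 := by
      intro n
      rw [← ae_restrict_iff' (hBm n), ae_iff]
      have hS : MeasurableSet {z : Fin N → 𝕜 | ¬ ∑ k, z k = 1} :=
        ((Finset.measurable_fun_sum _ fun k _ => measurable_pi_apply k)
          (measurableSet_singleton (1 : 𝕜))).compl
      refine (hlaw n _ hS).trans ?_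
      change μ.restrict (A n) {x | ¬ ∑ k, V x k = 1} = 0
      rw [← ae_iff, ae_restrict_iff' (hAm n)]
      filter_upwards [hsum] with x hx hxA
      simp only [V]
      rw [← Finset.sum_div, ← hx, div_self hxA.1]
    filter_upwards [ae_all_iff.2 hone] with y hy
    rw [← Finset.mul_sum]
    by_cases h0 : h y = 0
    · simp [h0]
    · rw [hy (idx y) ⟨h0, rfl⟩, mul_one]
  · have hcover : {y | a < ‖h y * W (idx y) y k‖ₑ} ⊆
        ⋃ n : ℤ, {y | a < ENNReal.ofReal (c ^ n) * ‖W n y k‖ₑ} ∩ B n := by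
      intro y hy
      have hy' : a < ‖h y * W (idx y) y k‖ₑ := hy
      have h0 : h y ≠ 0 := by
        intro h0
        simp [h0] at hy'
      have hyB : y ∈ B (idx y) := ⟨h0, rfl⟩
      refine mem_iUnion.2 ⟨idx y, hy'.trans_le ?_, hyB⟩
      rw [enorm_mul]
      gcongr
      rw [← ofReal_norm]
      exact ENNReal.ofReal_le_ofReal ((mem_normShell_iff hc).1 hyB).2
    have hterm : ∀ n : ℤ, ν ({y | a < ENNReal.ofReal (c ^ n) * ‖W n y k‖ₑ} ∩ B n) ≤
        μ ({x | a < ENNReal.ofReal c * ‖g k x‖ₑ} ∩ A n) := by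
      intro n
      have hS : MeasurableSet {z : Fin N → 𝕜 | a < ENNReal.ofReal (c ^ n) * ‖z k‖ₑ} :=
        measurableSet_lt measurable_const ((measurable_pi_apply k).enorm.const_mul _)
      have := hlaw n _ hS
      rw [Measure.restrict_apply' (hBm n), Measure.restrict_apply' (hAm n)] at this
      refine this.le.trans (measure_mono ?_)
      rintro x ⟨hx, hxA⟩
      have hx' : a < ENNReal.ofReal (c ^ n) * ‖V x k‖ₑ := hx
      refine ⟨mem_ofPred_eq ▸ lt_of_lt_of_le hx' ?_, hxA⟩
      have hlow := ((mem_normShell_iff hc).1 hxA).1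
      have hfx : 0 < ‖f x‖ := norm_pos_iff.2 hxA.1
      simp only [V]
      rw [← ofReal_norm, ← ofReal_norm, ← ENNReal.ofReal_mul (by positivity),
        ← ENNReal.ofReal_mul hc0.le, norm_div]
      refine ENNReal.ofReal_le_ofReal ?_
      rw [mul_div_assoc', div_le_iff₀ hfx]
      -- The only loss is here: on the shell `c^n / |f| < c`.
      have hpow : c ^ n = c * c ^ (n - 1) := by
        rw [← zpow_one_add₀ hc0.ne']; congr 1; ring
      rw [hpow]
      nlinarith [mul_le_mul_of_nonneg_left hlow.le (mul_nonneg hc0.le (norm_nonneg (g k x)))]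
    have hdisj : Pairwise (Function.onFun Disjoint fun n =>
        {x | a < ENNReal.ofReal c * ‖g k x‖ₑ} ∩ A n) := by
      intro m n hmn
      refine Set.disjoint_left.2 fun x hx hx' => hmn ?_
      exact hx.2.2.symm.trans hx'.2.2
    calc _ ≤ _ := measure_mono hcover
      _ ≤ ∑' n, ν ({y | a < ENNReal.ofReal (c ^ n) * ‖W n y k‖ₑ} ∩ B n) := measure_iUnion_le _
      _ ≤ ∑' n, μ ({x | a < ENNReal.ofReal c * ‖g k x‖ₑ} ∩ A n) := ENNReal.tsum_le_tsum hterm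
      _ = μ (⋃ n, {x | a < ENNReal.ofReal c * ‖g k x‖ₑ} ∩ A n) :=
        (measure_iUnion hdisj fun n => (measurableSet_lt measurable_const
          ((hg k).enorm.const_mul _)).inter (hAm n)).symm
      _ ≤ _ := measure_mono (iUnion_subset fun n => inter_subset_left)

/-- Only the target space has to be diffuse. The factor `c` from the shells passes to the Lorentz
functionals by homogeneity and disappears as `c ↓ 1`. -/
theorem decompositionNorm_le_of_equimeasurable (hν : IsDiffuse ν) {f : X → 𝕜} {h : Y → 𝕜}
    (hf : AEStronglyMeasurable f μ) (hh : AEStronglyMeasurable h ν)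
    (hdist : ∀ y, ν {x | y < ‖h x‖ₑ} = μ {x | y < ‖f x‖ₑ})
    (hfin : ∀ y, y ≠ 0 → μ {x | y < ‖f x‖ₑ} < ∞) (p : ℝ) {s : ℝ≥0∞} (hs : 1 ≤ s) :
    decompositionNorm p s ν h ≤ decompositionNorm p s μ f := by
  refine le_sInf ?_
  rintro _ ⟨N, g, hg, hsum, rfl⟩
  have hfeq := measure_lt_enorm_congr hf.ae_eq_mk
  have hheq := measure_lt_enorm_congr hh.ae_eq_mk
  have hsum' : ∀ᵐ x ∂μ, hf.mk f x = ∑ k, (hg k).1.mk (g k) x := by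
    filter_upwards [hsum, hf.ae_eq_mk, ae_all_iff.2 fun k => (hg k).1.ae_eq_mk] with x h1 h2 h3
    rw [← h2, h1]
    exact Finset.sum_congr rfl fun k _ => h3 k
  have key : ∀ c : ℝ, 1 < c → decompositionNorm p s ν h ≤
      ENNReal.ofReal c * ∑ k, lorentzNorm p s μ (g k) := by
    intro c hc
    obtain ⟨F, hF, hFsum, hFle⟩ := exists_transferred_decomposition (μ := μ) hν
      hf.stronglyMeasurable_mk.measurable hh.stronglyMeasurable_mk.measurable
      (fun y => by rw [← hheq, hdist, hfeq]) (fun y hy => hfeq y ▸ hfin y hy)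
      (fun k => (hg k).1.stronglyMeasurable_mk.measurable) hsum' hc
    have hle : ∀ k, lorentzNorm p s ν (F k) ≤ ENNReal.ofReal c * lorentzNorm p s μ (g k) := by
      intro k
      rw [lorentzNorm_congr p s (measure_lt_enorm_congr (hg k).1.ae_eq_mk)]
      refine lorentzNorm_le_mul p hs ?_ ENNReal.ofReal_ne_top (hFle k)
      rw [Ne, ENNReal.ofReal_eq_zero, not_le]; positivity
    rw [Finset.mul_sum]
    refine le_trans (sInf_le ⟨N, F, fun k => ⟨(hF k).aestronglyMeasurable, (hle k).trans_lt
      (ENNReal.mul_lt_top ENNReal.ofReal_lt_top (hg k).2)⟩, ?_, rfl⟩)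
      (Finset.sum_le_sum fun k _ => hle k)
    filter_upwards [hFsum, hh.ae_eq_mk] with y h1 h2
    rw [h2, h1]
  have hlim : Filter.Tendsto (fun c : ℝ => ENNReal.ofReal c * ∑ k, lorentzNorm p s μ (g k))
      (nhdsWithin 1 (Ioi 1)) (nhds (ENNReal.ofReal 1 * ∑ k, lorentzNorm p s μ (g k))) :=
    ENNReal.Tendsto.mul_const (ENNReal.continuous_ofReal.continuousWithinAt) (Or.inl (by simp))
  rw [ENNReal.ofReal_one, one_mul] at hlim
  refine ge_of_tendsto hlim ?_
  filter_upwards [self_mem_nhdsWithin] with c hc using key c hc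

end Transfer

/-! ### The two inequalities -/

theorem mainTheorem7 {𝕜 : Type*} [RCLike 𝕜] {R : Type*} [MeasurableSpace R]
    (μ : Measure R) [SigmaFinite μ] (hμ : IsNonatomic μ)
    (p : ℝ) (hp : 1 ≤ p) (s : ℝ≥0∞) (hs : 1 ≤ s)
    (f : R → 𝕜) (hf : MemLorentz p s μ f) :
    decompositionNorm p s μ f =
      decompositionNorm p s ((volume : Measure ℝ).restrict (Ioi 0))
        (fun t : ℝ => (((rearrangement μ f t).toReal : ℝ) : 𝕜)) := by
  have hp0 : 0 < p := zero_lt_one.trans_le hp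
  have hdist := volume_lt_enorm_rearrangement (𝕜 := 𝕜)
    (fun t ht => rearrangement_lt_top (μ := μ) (f := f) hs hp0 hf.2 ht)
  have hfin : ∀ y, y ≠ 0 → μ {x | y < ‖f x‖ₑ} < ∞ :=
    fun y hy => measure_lt_enorm_lt_top hs hp0 hf.2 hy
  have hmeas : AEStronglyMeasurable (fun t : ℝ => (((rearrangement μ f t).toReal : ℝ) : 𝕜))
      ((volume : Measure ℝ).restrict (Ioi 0)) :=
    (RCLike.measurable_ofReal.comp
      (rearrangement_antitone μ f).measurable.ennreal_toReal).aestronglyMeasurable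
  apply le_antisymm
  -- Decompositions of `f^*` are carried to `R`, which is diffuse by nonatomicity; the other
  -- inequality carries those of `f` to the half-line, where points are null.
  · exact decompositionNorm_le_of_equimeasurable hμ.isDiffuse hmeas hf.1
      (fun y => (hdist y).symm) (fun y hy => hdist y ▸ hfin y hy) p hs
  · refine decompositionNorm_le_of_equimeasurable (isDiffuse_of_nullSingleton _ fun c => ?_)
      hf.1 hmeas hdist hfin p hs
    exact measure_singleton c
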